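/- Let $S$ be a compact connected surface, possibly with boundary (for instance an orientable one with $\chi(S)<0$), let $\phi\colon S\to S$ be a (possibly orientation reversing) homeomorphism, and let $T=T_\phi$ be its mapping torus, i.e. the quotient of $S\times[0,1]$ by $(x,1)\sim(\phi(x),0)$. Suppose that the induced map $\phi^*$ on the singular cohomology $H^1(S,\mathbb R)$ is hyperbolic, i.e. $H^1(S,\mathbb R)\neq 0$ and no complex eigenvalue of $\phi^*$ has modulus $1$. Let $M$ be a compact smooth manifold, possibly disconnected and possibly with boundary or corners. Let $\mathrm{Diff}^1(M)$ be the group of $C^1$-diffeomorphisms of $M$ with the $C^1$-topology, i.e. the topology of the metric $d(f,g)=\sup_{x}|f(x)-g(x)|+\sup_{x}\|D_xf-D_xg\|$ measured through any $C^1$-embedding of $M$ in a Euclidean space, and give $\mathrm{Hom}(\pi_1(T),\mathrm{Diff}^1(M))$ the topology of pointwise convergence, i.e. the topology of the metric $\max_{a\in A}d(\rho(a),\rho'(a))$ for any finite generating set $A$ of $\pi_1(T)$. Then there is a neighborhood $\mathcal U$ of the trivial representation in $\mathrm{Hom}(\pi_1(T),\mathrm{Diff}^1(M))$ such that every $\rho\in\mathcal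 U$ is trivial on the fiber group, i.e. on the image of $\pi_1(S)\to\pi_1(T)$ induced by the inclusion $x\mapsto[(x,0)]$ of the fiber. -/

import Mathlib

open Set Topology
open scoped Manifold ContDiff TensorProduct ENNReal

noncomputable section

/-! ### Real singular cohomology in degree one -/

namespace SingularCohomology

universe u v

variable {X : Type u} {Y : Type v} [TopologicalSpace X] [TopologicalSpace Y]

/-- Singular `n`-simplices of `X`: continuous maps from the standard `n`-simplex to `X`. -/
abbrev Simplex (n : ℕ) (X : Type u) [TopologicalSpace X] : Type u :=
  C(stdSimplex ℝ (Fin (n + 1)), X)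

/-- Real singular `n`-cochains: arbitrary real functions on the singular `n`-simplices, i.e. linear
functionals on the real vector space of singular `n`-chains. -/
abbrev Cochain (n : ℕ) (X : Type u) [TopologicalSpace X] : Type u :=
  Simplex n X → ℝ

/-- The inclusion of the `i`-th face, opposite to the `i`-th vertex, of the standard simplex. -/
def faceMap (n : ℕ) (i : Fin (n + 2)) :
    C(stdSimplex ℝ (Fin (n + 1)), stdSimplex ℝ (Fin (n + 2))) :=
  ⟨stdSimplex.map i.succAbove, stdSimplex.continuous_map _⟩

/-- The singular coboundary `(δ c)(s) = ∑ᵢ (-1)ⁱ c(i-th face of s)`. -/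
def coboundary (n : ℕ) (X : Type u) [TopologicalSpace X] :
    Cochain n X →ₗ[ℝ] Cochain (n + 1) X where
  toFun c s := ∑ i : Fin (n + 2), (-1 : ℝ) ^ (i : ℕ) * c (s.comp (faceMap n i))
  map_add' c d := by
    funext s
    simp [mul_add, Finset.sum_add_distrib]
  map_smul' r c := by
    funext s
    simp [Finset.mul_sum, mul_left_comm]

/-- Singular `1`-cocycles. -/
abbrev cocycles₁ (X : Type u) [TopologicalSpace X] : Submodule ℝ (Cochain 1 X) :=
  LinearMap.ker (coboundary 1 X)

/-- The singular `1`-coboundaries, as a subspace of the `1`-cocycles. -/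
abbrev coboundaries₁ (X : Type u) [TopologicalSpace X] : Submodule ℝ (cocycles₁ X) :=
  (LinearMap.range (coboundary 0 X)).comap (cocycles₁ X).subtype

/-- The first real singular cohomology `H¹(X; ℝ)`. -/
abbrev H1 (X : Type u) [TopologicalSpace X] : Type u :=
  cocycles₁ X ⧸ coboundaries₁ X

/-- Pull-back of singular cochains along a continuous map. -/
def cochainPullback (n : ℕ) (f : C(X, Y)) : Cochain n Y →ₗ[ℝ] Cochain n X where
  toFun c s := c (f.comp s)
  map_add' _ _ := rfl
  map_smul' _ _ := rfl

theorem coboundary_pullback (n : ℕ) (f : C(X, Y)) (c : Cochain n Y) :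
    coboundary n X (cochainPullback n f c) = cochainPullback (n + 1) f (coboundary n Y c) :=
  rfl

/-- Pull-back of singular `1`-cocycles. -/
def cocyclePullback (f : C(X, Y)) : cocycles₁ Y →ₗ[ℝ] cocycles₁ X :=
  (cochainPullback 1 f).restrict fun c hc => by
    rw [LinearMap.mem_ker] at hc ⊢
    rw [coboundary_pullback, hc, map_zero]

/-- The map `f^* : H¹(Y; ℝ) → H¹(X; ℝ)` induced by a continuous map `f : X → Y`. -/
def pullback (f : C(X, Y)) : H1 Y →ₗ[ℝ] H1 X :=
  Submodule.mapQ (coboundaries₁ Y) (coboundaries₁ X) (cocyclePullback f) (by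
    rintro c ⟨b, hb⟩
    refine ⟨cochainPullback 0 f b, ?_⟩
    rw [coboundary_pullback, hb]
    rfl)

end SingularCohomology

/-! ### Hyperbolic linear maps -/

/-- A linear endomorphism `A` of a real vector space `V` is hyperbolic if `V ≠ 0` and no complex
eigenvalue of `A` (i.e. eigenvalue of the complexification of `A`) has modulus one. -/
def IsHyperbolic {V : Type*} [AddCommGroup V] [Module ℝ V] (A : V →ₗ[ℝ] V) : Prop :=
  Nontrivial V ∧
    ∀ z : ℂ, Module.End.HasEigenvalue (LinearMap.baseChange ℂ A : Module.End ℂ (ℂ ⊗[ℝ] V)) z →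
      ‖z‖ ≠ 1

/-! ### Mapping tori -/

/-- The relation `(x, 1) ∼ (φ x, 0)` on `S × [0, 1]`. -/
def mappingTorusRel {S : Type*} [TopologicalSpace S] (φ : S ≃ₜ S) (p q : S × unitInterval) : Prop :=
  p.2 = 1 ∧ q.2 = 0 ∧ q.1 = φ p.1

/-- The mapping torus of a homeomorphism `φ : S → S`: the quotient of `S × [0, 1]` by the
equivalence relation generated by `(x, 1) ∼ (φ x, 0)`. -/
def MappingTorus {S : Type*} [TopologicalSpace S] (φ : S ≃ₜ S) : Type _ :=
  Quot (mappingTorusRel φ)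

namespace MappingTorus

variable {S : Type*} [TopologicalSpace S] (φ : S ≃ₜ S)

/-- The quotient topology. -/
instance : TopologicalSpace (MappingTorus φ) :=
  inferInstanceAs (TopologicalSpace (Quot (mappingTorusRel φ)))

/-- The inclusion `x ↦ [(x, 0)]` of the fiber `S` in the mapping torus. -/
def fiberIncl : C(S, MappingTorus φ) where
  toFun x := Quot.mk _ (x, 0)
  continuous_toFun := continuous_quot_mk.comp (by fun_prop)

/-- The fiber group: the image of `π₁(S, x₀)` in the fundamental group of the mapping torus. -/
def fiberGroup (x₀ : S) : Subgroup (FundamentalGroup (MappingTorus φ) (fiberIncl φ x₀)) :=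
  (FundamentalGroup.map (fiberIncl φ) x₀).range

end MappingTorus

/-! ### The group of `C¹` diffeomorphisms and its `C¹` topology -/

section Diff

variable {E : Type*} [NormedAddCommGroup E] [NormedSpace ℝ E] {H : Type*} [TopologicalSpace H]
  (I : ModelWithCorners ℝ E H) (M : Type*) [TopologicalSpace M] [ChartedSpace H M]

/-- The `C¹` diffeomorphisms of `M`. -/
abbrev Diff1 : Type _ := M ≃ₘ^1⟮I, I⟯ M

/-- The group structure on `Diff¹(M)`, given by composition `(f * g) x = f (g x)`. -/
instance Diff1.instGroup : Group (Diff1 I M) where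
  mul f g := g.trans f
  one := Diffeomorph.refl I M 1
  inv f := f.symm
  mul_assoc _ _ _ := rfl
  one_mul _ := rfl
  mul_one _ := rfl
  inv_mul_cancel f := Diffeomorph.ext fun x => f.symm_apply_apply x

variable {M}

/-- A `C¹` embedding of `M` in the Euclidean space `ℝᴺ`. -/
structure IsC1Embedding {N : ℕ} (e : M → EuclideanSpace ℝ (Fin N)) : Prop where
  contMDiff : ContMDiff I 𝓘(ℝ, EuclideanSpace ℝ (Fin N)) 1 e
  isEmbedding : IsEmbedding e
  injective_mfderiv : ∀ x, Function.Injective (mfderiv I 𝓘(ℝ, EuclideanSpace ℝ (Fin N)) e x)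

/-- For `M ⊆ ℝᴺ` via `e`, the derivative at `x` of a map `g : M → ℝᴺ`, as a linear map from the
tangent space `T_x M` to `ℝᴺ`. -/
def ambientDeriv {N : ℕ} (g : M → EuclideanSpace ℝ (Fin N)) (x : M) :
    TangentSpace I x →L[ℝ] EuclideanSpace ℝ (Fin N) :=
  mfderiv I 𝓘(ℝ, EuclideanSpace ℝ (Fin N)) g x

/-- The `C¹` distance `sup_x |f x - g x| + sup_x ‖D_x f - D_x g‖` of two diffeomorphisms, measured
in `ℝᴺ` via an embedding `e`. Here `‖·‖` is the operator norm of linear maps `T_x M → ℝᴺ`, where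
`T_x M` is regarded as a subspace of `ℝᴺ` through the derivative of `e`. -/
def c1EDist {N : ℕ} (e : M → EuclideanSpace ℝ (Fin N)) (f g : Diff1 I M) : ℝ≥0∞ :=
  (⨆ x : M, edist (e (f x)) (e (g x))) +
    ⨆ (x : M) (v : TangentSpace I x) (_ : ‖ambientDeriv I e x v‖ ≤ 1),
      edist (ambientDeriv I (e ∘ f) x v) (ambientDeriv I (e ∘ g) x v)

/-- The `C¹` distance as a (pseudo-)metric on `Diff¹(M)`. -/
abbrev c1PseudoEMetric {N : ℕ} (e : M → EuclideanSpace ℝ (Fin N)) :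
    PseudoEMetricSpace (Diff1 I M) where
  edist := c1EDist I e
  edist_self f := by simp [c1EDist]
  edist_comm f g := by simp only [c1EDist, edist_comm]
  edist_triangle f g h := by
    refine (add_le_add (b := (⨆ x : M, edist (e (f x)) (e (g x))) +
      ⨆ x : M, edist (e (g x)) (e (h x)))
      (d := (⨆ (x : M) (v : TangentSpace I x) (_ : ‖ambientDeriv I e x v‖ ≤ 1),
        edist (ambientDeriv I (e ∘ f) x v) (ambientDeriv I (e ∘ g) x v)) +
        ⨆ (x : M) (v : TangentSpace I x) (_ : ‖ambientDeriv I e x v‖ ≤ 1),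
        edist (ambientDeriv I (e ∘ g) x v) (ambientDeriv I (e ∘ h) x v)) ?_ ?_).trans
      (add_add_add_comm _ _ _ _).le
    · refine iSup_le fun x => (edist_triangle _ (e (g x)) _).trans (add_le_add ?_ ?_)
      · exact le_iSup (fun x : M => edist (e (f x)) (e (g x))) x
      · exact le_iSup (fun x : M => edist (e (g x)) (e (h x))) x
    · refine iSup_le fun x => iSup_le fun v => iSup_le fun hv =>
        (edist_triangle _ (ambientDeriv I (e ∘ g) x v) _).trans (add_le_add ?_ ?_)
      · exact le_iSup_of_le x (le_iSup_of_le v (le_iSup_of_le hv le_rfl))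
      · exact le_iSup_of_le x (le_iSup_of_le v (le_iSup_of_le hv le_rfl))

/-- The `C¹` topology on `Diff¹(M)`, for compact `M`: the topology of the `C¹` distance for an
embedding of `M` in a Euclidean space. All `C¹` embeddings of a compact manifold define the same
topology; to avoid a choice, we take the coarsest topology containing those of all `C¹`
embeddings. -/
instance Diff1.instTopologicalSpace : TopologicalSpace (Diff1 I M) :=
  ⨅ (N : ℕ) (e : M → EuclideanSpace ℝ (Fin N)) (_ : IsC1Embedding I e),
    (c1PseudoEMetric I e).toUniformSpace.toTopologicalSpace

/-- The `C¹` topology on `Hom(G, Diff¹(M))`: the topology of pointwise convergence on `G`. If `G` is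
generated by a finite set `A`, it is the topology of the distance `max_{a ∈ A} d(ρ a, ρ' a)`, where
`d` is the `C¹` distance. -/
instance Diff1.instTopologicalSpaceHom (G : Type*) [Group G] : TopologicalSpace (G →* Diff1 I M) :=
  TopologicalSpace.induced (fun ρ g => ρ g) inferInstance

end Diff

end

noncomputable section

namespace Path.Homotopic

variable {X : Type*} [TopologicalSpace X]

/-- Any two paths with the same endpoints whose ranges lie in `U` are homotopic in the ambient
space. -/
def UniqueIn (U : Set X) : Prop :=
  ∀ ⦃x y : X⦄ (p q : Path x y), range p ⊆ U → range q ⊆ U → p.Homotopic q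

theorem UniqueIn.mono {U V : Set X} (hV : UniqueIn V) (h : U ⊆ V) : UniqueIn U :=
  fun _ _ p q hp hq => hV p q (hp.trans h) (hq.trans h)

theorem UniqueIn.of_simplyConnected {K : Type*} [TopologicalSpace K] [SimplyConnectedSpace K]
    {U : Set X} (f : C(K, X)) (g : C(U, K)) (hfg : ∀ u, f (g u) = u) : UniqueIn U := by
  intro x y p q hp hq
  have hp' : ∀ t, p t ∈ U := fun t => hp (mem_range_self t)
  have hq' : ∀ t, q t ∈ U := fun t => hq (mem_range_self t)
  have hx : x ∈ U := by simpa using hp' 0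
  have hy : y ∈ U := by simpa using hp' 1
  let p' : Path (g ⟨x, hx⟩) (g ⟨y, hy⟩) :=
    { toFun := fun t => g ⟨p t, hp' t⟩
      continuous_toFun := by fun_prop
      source' := by simp
      target' := by simp }
  let q' : Path (g ⟨x, hx⟩) (g ⟨y, hy⟩) :=
    { toFun := fun t => g ⟨q t, hq' t⟩
      continuous_toFun := by fun_prop
      source' := by simp
      target' := by simp }
  have h := ((SimplyConnectedSpace.paths_homotopic p' q').map f).pathCast
    (hfg ⟨x, hx⟩).symm (hfg ⟨y, hy⟩).symm
  convert h using 1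
  · ext t
    exact (hfg ⟨p t, hp' t⟩).symm
  · ext t
    exact (hfg ⟨q t, hq' t⟩).symm

/-- The loop at `x₀` obtained from a homotopy class of paths by joining its endpoints to `x₀`
through a fixed family of paths. -/
def Quotient.based {x₀ : X} (c : ∀ y, Path x₀ y) {y z : X} (η : Path.Homotopic.Quotient y z) :
    FundamentalGroup X x₀ :=
  ((Quotient.mk (c y)).trans η).trans (Quotient.mk (c z)).symm

section Based

variable {x₀ : X} (c : ∀ y, Path x₀ y)

@[simp] theorem Quotient.based_refl (y : X) : (Quotient.refl y).based c = 1 := by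
  simp [Quotient.based]
  rfl

theorem Quotient.based_trans {y z w : X} (η : Path.Homotopic.Quotient y z)
    (θ : Path.Homotopic.Quotient z w) :
    (η.trans θ).based c = θ.based c * η.based c := by
  simp only [Quotient.based, FundamentalGroup.mul_def, Quotient.trans_assoc]
  rw [← Quotient.trans_assoc (Quotient.mk (c z)).symm (Quotient.mk (c z)), Quotient.symm_trans,
    Quotient.refl_trans]

theorem Quotient.based_symm {y z : X} (η : Path.Homotopic.Quotient y z) :
    η.symm.based c = (η.based c)⁻¹ := by
  rw [eq_inv_iff_mul_eq_one, ← Quotient.based_trans, Quotient.trans_symm, Quotient.based_refl]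

theorem Quotient.based_loop (η : FundamentalGroup X x₀) :
    Quotient.based c (y := x₀) (z := x₀) η =
      (FundamentalGroup.fromPath (Quotient.mk (c x₀)))⁻¹ * η *
        FundamentalGroup.fromPath (Quotient.mk (c x₀)) := by
  simp [Quotient.based, FundamentalGroup.mul_def, FundamentalGroup.inv_def, Quotient.trans_assoc]

theorem Quotient.based_loop_surjective :
    Function.Surjective fun η : FundamentalGroup X x₀ => Quotient.based c (y := x₀) (z := x₀) η := by
  intro η
  refine ⟨FundamentalGroup.fromPath (Quotient.mk (c x₀)) * η *
    (FundamentalGroup.fromPath (Quotient.mk (c x₀)))⁻¹, ?_⟩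
  simp only [Quotient.based_loop]
  group

theorem Quotient.based_cast {y z y' z' : X} (η : Path.Homotopic.Quotient y z) (hy : y' = y)
    (hz : z' = z) : (η.cast hy hz).based c = η.based c := by
  subst hy hz
  rw [Quotient.cast_rfl_rfl]

end Based

end Path.Homotopic

open Path in
/-- A compact path-connected space in which small sets carry unique homotopy classes of paths has a
finitely generated fundamental group. -/
theorem FundamentalGroup.fg_of_compactSpace {X : Type*} [TopologicalSpace X] [CompactSpace X]
    [T2Space X] [PathConnectedSpace X] [LocallyPathConnectedSpace X]
    (h : ∀ x : X, ∃ U ∈ 𝓝 x, Homotopic.UniqueIn U) (x₀ : X) : Group.FG (FundamentalGroup X x₀) := by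
  let : UniformSpace X := uniformSpaceOfCompactR1
  choose U hU hUu using h
  obtain ⟨V, hV, hVU⟩ := lebesgue_number_lemma (isCompact_univ (X := X))
    (fun x => isOpen_interior (s := U x))
    (fun x _ => mem_iUnion.2 ⟨x, mem_interior_iff_mem_nhds.2 (hU x)⟩)
  obtain ⟨W, hW, hWs, hWV⟩ := comp_symm_mem_uniformity_sets hV
  have hsmall : ∀ x : X, ∃ P : Set X, IsOpen P ∧ x ∈ P ∧ IsPathConnected P ∧ P ⊆ UniformSpace.ball x W := by
    intro x
    obtain ⟨P, ⟨hP, hxP, hPc⟩, hPW⟩ :=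
      (isOpen_isPathConnected_basis x).mem_iff.1 (UniformSpace.ball_mem_nhds x hW)
    exact ⟨P, hP, hxP, hPc, hPW⟩
  choose P hPo hPx hPc hPW using hsmall
  obtain ⟨s, hs⟩ := isCompact_univ.elim_finite_subcover P hPo fun x _ => mem_iUnion.2 ⟨x, hPx x⟩
  have hcov : ∀ y, ∃ k ∈ s, y ∈ P k := fun y => by simpa using hs (mem_univ y)
  have hunion : ∀ k l, (P k ∩ P l).Nonempty → Homotopic.UniqueIn (P k ∪ P l) := by
    rintro k l ⟨z, hzk, hzl⟩
    obtain ⟨i, hi⟩ := hVU z (mem_univ z)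
    refine (hUu i).mono (Subset.trans ?_ (hi.trans interior_subset))
    have key : ∀ m, z ∈ P m → P m ⊆ UniformSpace.ball z V := fun m hm y hy =>
      hWV (UniformSpace.mem_ball_comp (hWs.symm _ _ (hPW m hm)) (hPW m hy))
    exact union_subset (key k hzk) (key l hzl)
  let c : ∀ y, Path x₀ y := PathConnectedSpace.somePath x₀
  let A : X → X → Set (FundamentalGroup X x₀) := fun k l =>
    {g | (P k ∩ P l).Nonempty ∧ ∃ η : Path k l, range η ⊆ P k ∪ P l ∧ g = (Homotopic.Quotient.mk η).based c}
  let B : X → Set (FundamentalGroup X x₀) := fun k =>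
    {g | ∃ y, y = x₀ ∧ ∃ η : Path k y, range η ⊆ P k ∧ g = (Homotopic.Quotient.mk η).based c}
  have hA : ∀ k l, (A k l).Finite := by
    refine fun k l => Set.Subsingleton.finite ?_
    rintro _ ⟨hkl, η, hη, rfl⟩ _ ⟨-, θ, hθ, rfl⟩
    rw [Homotopic.Quotient.eq.2 (hunion k l hkl η θ hη hθ)]
  have hB : ∀ k, (B k).Finite := by
    refine fun k => Set.Subsingleton.finite ?_
    rintro _ ⟨_, rfl, η, hη, rfl⟩ _ ⟨_, rfl, θ, hθ, rfl⟩
    rw [Homotopic.Quotient.eq.2 (((hunion k k ⟨k, hPx k, hPx k⟩).mono subset_union_left) η θ hη hθ)]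
  let G : Set (FundamentalGroup X x₀) := (⋃ k ∈ s, ⋃ l ∈ s, A k l) ∪ ⋃ k ∈ s, B k
  have hG : G.Finite := (s.finite_toSet.biUnion fun k _ => s.finite_toSet.biUnion fun l _ => hA k l).union
    (s.finite_toSet.biUnion fun k _ => hB k)
  refine Group.fg_iff.2 ⟨G, ?_, hG⟩
  have hAG : ∀ k ∈ s, ∀ l ∈ s, ∀ g ∈ A k l, g ∈ Subgroup.closure G := fun k hk l hl g hg =>
    Subgroup.subset_closure (Or.inl (mem_biUnion hk (mem_biUnion hl hg)))
  have hBG : ∀ k ∈ s, ∀ g ∈ B k, g ∈ Subgroup.closure G := fun k hk g hg =>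
    Subgroup.subset_closure (Or.inr (mem_biUnion hk hg))
  rw [eq_top_iff]
  intro g _
  obtain ⟨g, rfl⟩ := Homotopic.Quotient.based_loop_surjective c g
  obtain ⟨γ, rfl⟩ := Homotopic.Quotient.mk_surjective g
  obtain ⟨t, ht0, htm, ⟨n, hn⟩, hts⟩ := exists_monotone_Icc_subset_open_cover_unitInterval
    (c := fun k : s => γ ⁻¹' P k) (fun k => (hPo k).preimage γ.continuous)
    (fun u _ => by simpa using hcov (γ u))
  have claim : ∀ n, ∃ k ∈ s, ∃ σ : Path k (γ (t n)), range σ ⊆ P k ∧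
      ((Homotopic.Quotient.mk σ).based c)⁻¹ * (Homotopic.Quotient.mk (γ.subpath 0 (t n))).based c ∈
        Subgroup.closure G := by
    intro n
    induction n with
    | zero =>
      obtain ⟨k, hk, hγk⟩ := hcov (γ (t 0))
      have hj := (hPc k).joinedIn k (hPx k) _ hγk
      refine ⟨k, hk, hj.somePath, range_subset_iff.2 hj.somePath_mem, ?_⟩
      have h1 : (Homotopic.Quotient.mk (γ.subpath 0 (t 0))).based c = 1 := by
        rw [ht0, Path.subpath_self, Homotopic.Quotient.mk_refl, Homotopic.Quotient.based_refl]
      rw [h1, mul_one]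
      exact inv_mem (hBG k hk _ ⟨_, by rw [ht0, γ.source], _,
        range_subset_iff.2 hj.somePath_mem, rfl⟩)
    | succ n ih =>
      obtain ⟨k, hk, σ, hσ, hmem⟩ := ih
      obtain ⟨⟨l, hl⟩, htl⟩ := hts n
      have hyl : γ (t n) ∈ P l := htl ⟨le_rfl, htm n.le_succ⟩
      have hyk : γ (t n) ∈ P k := by simpa using hσ (mem_range_self 1)
      have hj := (hPc l).joinedIn l (hPx l) _ hyl
      refine ⟨l, hl, hj.somePath.trans (γ.subpath (t n) (t (n + 1))), ?_, ?_⟩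
      · rw [Path.trans_range, Path.range_subpath_of_le _ _ _ (htm n.le_succ)]
        exact union_subset (range_subset_iff.2 hj.somePath_mem) (image_subset_iff.2 htl)
      · have h1 : Homotopic.Quotient.mk (γ.subpath 0 (t (n + 1))) = (Homotopic.Quotient.mk (γ.subpath 0 (t n))).trans
            (Homotopic.Quotient.mk (γ.subpath (t n) (t (n + 1)))) := by
          rw [← Homotopic.Quotient.mk_trans]
          exact (Homotopic.Quotient.eq.2 ⟨Path.Homotopy.subpathTransSubpath γ _ _ _⟩).symm
        have h2 := hAG k hk l hl _ ⟨⟨_, hyk, hyl⟩, σ.trans hj.somePath.symm, by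
          rw [Path.trans_range, Path.symm_range]
          exact union_subset_union hσ (range_subset_iff.2 hj.somePath_mem), rfl⟩
        have h3 := mul_mem h2 hmem
        rw [Homotopic.Quotient.mk_trans, Homotopic.Quotient.mk_symm, Homotopic.Quotient.based_trans, Homotopic.Quotient.based_symm] at h3
        rw [h1, Homotopic.Quotient.mk_trans, Homotopic.Quotient.based_trans, Homotopic.Quotient.based_trans]
        convert h3 using 1
        group
  obtain ⟨k, hk, σ, hσ, hmem⟩ := claim n
  have h1 := mul_mem (hBG k hk _ ⟨_, by rw [hn n le_rfl, γ.target], σ, hσ, rfl⟩) hmem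
  rw [mul_inv_cancel_left, hn n le_rfl, Path.subpath_zero_one, Homotopic.Quotient.mk_cast,
    Homotopic.Quotient.based_cast] at h1
  exact h1

/-- Points of a surface with boundary have neighborhoods in which paths are unique up to
homotopy. -/
theorem ChartedSpace.exists_uniqueIn_nhds {S : Type*} [TopologicalSpace S] {n : ℕ} [NeZero n]
    [ChartedSpace (EuclideanHalfSpace n) S] (x : S) :
    ∃ U ∈ 𝓝 x, Path.Homotopic.UniqueIn U := by
  let e := chartAt (EuclideanHalfSpace n) x
  have hx : x ∈ e.source := mem_chart_source _ x
  have htgt : e.target ∈ 𝓝 (e x) := e.open_target.mem_nhds (e.map_source hx)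
  obtain ⟨O, hO, hOe⟩ := mem_nhds_induced _ _ _ |>.1 htgt
  obtain ⟨r, hr, hrO⟩ := Metric.mem_nhds_iff.1 hO
  let K : Set (EuclideanSpace ℝ (Fin n)) := Metric.ball (e x).1 r ∩ {v | 0 ≤ v 0}
  have hK : Convex ℝ K := (convex_ball _ _).inter EuclideanHalfSpace.convex
  have : ContractibleSpace K := hK.contractibleSpace ⟨(e x).1, Metric.mem_ball_self hr, (e x).2⟩
  let j : K → EuclideanHalfSpace n := fun v => ⟨v.1, v.2.2⟩
  have hj : Continuous j := Continuous.subtype_mk continuous_subtype_val _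
  have hjt : ∀ v : K, j v ∈ e.target := fun v => hOe (hrO v.2.1)
  let U : Set S := e.source ∩ e ⁻¹' (Subtype.val ⁻¹' Metric.ball (e x).1 r)
  have hgc : Continuous fun u : U => e u.1 :=
    (e.continuousOn.mono inter_subset_left).domRestrict
  refine ⟨U, (e.isOpen_inter_preimage (Metric.isOpen_ball.preimage continuous_subtype_val)).mem_nhds
    ⟨hx, Metric.mem_ball_self hr⟩, Path.Homotopic.UniqueIn.of_simplyConnected (K := K)
    ⟨fun v => e.symm (j v), e.continuousOn_symm.comp_continuous hj hjt⟩
    ⟨fun u => ⟨(e u.1).1, u.2.2, (e u.1).2⟩,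
      Continuous.subtype_mk (continuous_subtype_val.comp hgc) _⟩ fun u => e.left_inv u.2.1⟩

end

noncomputable section

instance stdSimplex.instContractibleSpace {ι : Type*} [Fintype ι] [Nonempty ι] :
    ContractibleSpace (stdSimplex ℝ ι) :=
  (convex_stdSimplex ℝ ι).contractibleSpace
    (isPathConnected_stdSimplex ι).nonempty

instance unitInterval.instContractibleSpace : ContractibleSpace unitInterval :=
  (convex_Icc (0 : ℝ) 1).contractibleSpace ⟨0, unitInterval.zero_mem⟩

namespace Path.Homotopic.Quotient

variable {X Y : Type*} [TopologicalSpace X] [TopologicalSpace Y]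

theorem map_trans {x y z : X} (p : Path.Homotopic.Quotient x y) (q : Path.Homotopic.Quotient y z)
    (f : C(X, Y)) : (p.trans q).map f = (p.map f).trans (q.map f) :=
  (FundamentalGroupoid.map f).map_comp (X := ⟨x⟩) (Y := ⟨y⟩) (Z := ⟨z⟩) p q

theorem map_symm {x y : X} (p : Path.Homotopic.Quotient x y) (f : C(X, Y)) :
    p.symm.map f = (p.map f).symm := by
  obtain ⟨p, rfl⟩ := mk_surjective p
  rw [← mk_symm, ← mk_map, ← mk_map, ← mk_symm]
  rfl

theorem map_bijective (φ : X ≃ₜ Y) (x y : X) :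
    Function.Bijective fun p : Path.Homotopic.Quotient x y => p.map (φ : C(X, Y)) := by
  constructor
  · intro p q h
    obtain ⟨p, rfl⟩ := mk_surjective p
    obtain ⟨q, rfl⟩ := mk_surjective q
    simp only [← mk_map] at h
    have h' := ((exact h).map (φ.symm : C(Y, X))).pathCast (φ.symm_apply_apply x).symm
      (φ.symm_apply_apply y).symm
    refine eq.2 ?_
    convert h' using 1 <;>
    · ext t
      simp
  · intro q
    obtain ⟨q, rfl⟩ := mk_surjective q
    refine ⟨mk ((q.map φ.symm.continuous).cast (φ.symm_apply_apply x).symm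
      (φ.symm_apply_apply y).symm), ?_⟩
    simp only [← mk_map]
    congr 1
    ext t
    simp

variable {K L : Type*} [TopologicalSpace K] [TopologicalSpace L] [SimplyConnectedSpace K]
  [SimplyConnectedSpace L] {x₀ : X} (c : ∀ y, Path x₀ y)

/-- The loop determined by the images of two points under a map from a simply connected space. -/
def edgeLoop (s : C(K, X)) (p q : K) : FundamentalGroup X x₀ :=
  ((mk (PathConnectedSpace.somePath p q)).map s).based c

theorem edgeLoop_eq (s : C(K, X)) {p q : K} (η : Path.Homotopic.Quotient p q) :
    edgeLoop c s p q = (η.map s).based c := by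
  rw [edgeLoop, Subsingleton.elim (mk (PathConnectedSpace.somePath p q)) η]

theorem edgeLoop_trans (s : C(K, X)) (p q r : K) :
    edgeLoop c s p r = edgeLoop c s q r * edgeLoop c s p q := by
  rw [edgeLoop_eq c s ((mk (PathConnectedSpace.somePath p q)).trans
    (mk (PathConnectedSpace.somePath q r))), map_trans, based_trans]
  rfl

theorem edgeLoop_comp (s : C(K, X)) (g : C(L, K)) (p q : L) :
    edgeLoop c (s.comp g) p q = edgeLoop c s (g p) (g q) := by
  rw [edgeLoop_eq c s ((mk (PathConnectedSpace.somePath p q)).map g), ← map_comp, edgeLoop]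

theorem edgeLoop_path {x y : X} (γ : Path x y) :
    edgeLoop c γ.toContinuousMap 0 1 = (mk γ).based c := by
  rw [edgeLoop_eq c _ (mk (⟨ContinuousMap.id _, rfl, rfl⟩ : Path (0 : unitInterval) 1)), ← mk_map,
    ← based_cast c (mk γ) γ.source γ.target, ← mk_cast]
  congr 1

theorem symm_trans_cancel {x y z : X} (p : Path.Homotopic.Quotient x y)
    (q : Path.Homotopic.Quotient y z) : p.symm.trans (p.trans q) = q := by
  rw [← trans_assoc, symm_trans, refl_trans]

end Path.Homotopic.Quotient

open Path

/-- The automorphism of the fundamental group induced by a homeomorphism and a path from the base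
point to its image. -/
def FundamentalGroup.mapAut {X : Type*} [TopologicalSpace X] {x₀ : X} (φ : X ≃ₜ X)
    (δ : Path x₀ (φ x₀)) : MulAut (FundamentalGroup X x₀) :=
  (MulEquiv.ofBijective (FundamentalGroup.map (φ : C(X, X)) x₀)
    (Homotopic.Quotient.map_bijective φ x₀ x₀) :
      FundamentalGroup X x₀ ≃* FundamentalGroup X (φ x₀)).trans (fundamentalGroupMulEquivOfPath δ.symm)

theorem FundamentalGroup.mapAut_apply {X : Type*} [TopologicalSpace X] {x₀ : X} (φ : X ≃ₜ X)
    (δ : Path x₀ (φ x₀)) (γ : FundamentalGroup X x₀) :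
    mapAut φ δ γ = ((Homotopic.Quotient.mk δ).trans (Homotopic.Quotient.map γ (φ : C(X, X)))).trans
      (Homotopic.Quotient.mk δ).symm := by
  change (Homotopic.Quotient.mk δ.symm).symm.trans
    ((Homotopic.Quotient.map γ (φ : C(X, X))).trans (Homotopic.Quotient.mk δ.symm)) = _
  rw [← Homotopic.Quotient.mk_symm, Path.symm_symm, Homotopic.Quotient.trans_assoc,
    Homotopic.Quotient.mk_symm]

namespace SingularCohomology

variable {X : Type*} [TopologicalSpace X] {x₀ : X} (c : ∀ y, Path x₀ y)

theorem faceMap_vertex (n : ℕ) (i : Fin (n + 2)) (j : Fin (n + 1)) :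
    faceMap n i (stdSimplex.vertex j) = stdSimplex.vertex (i.succAbove j) :=
  stdSimplex.map_vertex _ _

/-- The singular cocycle associated with an additive character of the fundamental group. -/
def charCocycle : (Additive (FundamentalGroup X x₀) →+ ℝ) →ₗ[ℝ] cocycles₁ X where
  toFun u := ⟨fun s => u (.ofMul (Homotopic.Quotient.edgeLoop c s (stdSimplex.vertex 0)
    (stdSimplex.vertex 1))), by
    rw [LinearMap.mem_ker]
    funext s
    change ∑ i : Fin 3, (-1 : ℝ) ^ (i : ℕ) * u (.ofMul (Homotopic.Quotient.edgeLoop c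
      (s.comp (faceMap 1 i)) (stdSimplex.vertex 0) (stdSimplex.vertex 1))) = 0
    rw [Fin.sum_univ_three]
    simp only [Homotopic.Quotient.edgeLoop_comp, faceMap_vertex]
    change (-1) ^ 0 * u (.ofMul (Homotopic.Quotient.edgeLoop c s
      (stdSimplex.vertex (1 : Fin 3)) (stdSimplex.vertex 2))) + (-1) ^ 1 *
      u (.ofMul (Homotopic.Quotient.edgeLoop c s (stdSimplex.vertex (0 : Fin 3))
        (stdSimplex.vertex 2))) + (-1) ^ 2 * u (.ofMul (Homotopic.Quotient.edgeLoop c s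
          (stdSimplex.vertex (0 : Fin 3)) (stdSimplex.vertex 1))) = 0
    rw [Homotopic.Quotient.edgeLoop_trans c s (stdSimplex.vertex (0 : Fin 3))
      (stdSimplex.vertex 1) (stdSimplex.vertex 2), ofMul_mul, map_add]
    ring⟩
  map_add' _ _ := rfl
  map_smul' _ _ := rfl

/-- The class in `H¹(X; ℝ)` of an additive character of the fundamental group. -/
def charClass : (Additive (FundamentalGroup X x₀) →+ ℝ) →ₗ[ℝ] H1 X :=
  (coboundaries₁ X).mkQ ∘ₗ charCocycle c

theorem coboundary_zero_apply (b : Cochain 0 X) (s : Simplex 1 X) :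
    coboundary 0 X b s = b (s.comp (faceMap 0 0)) - b (s.comp (faceMap 0 1)) := by
  simp [coboundary, Fin.sum_univ_two, sub_eq_add_neg]

theorem charClass_injective : Function.Injective (charClass (X := X) c) := by
  rw [injective_iff_map_eq_zero]
  intro u hu
  obtain ⟨b, hb⟩ := (Submodule.Quotient.mk_eq_zero _).1 hu
  ext g
  obtain ⟨g, rfl⟩ := Additive.ofMul.surjective g
  obtain ⟨g, rfl⟩ := Homotopic.Quotient.based_loop_surjective c g
  obtain ⟨γ, rfl⟩ := Homotopic.Quotient.mk_surjective g
  let h : C(stdSimplex ℝ (Fin 2), unitInterval) := stdSimplexHomeomorphUnitInterval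
  have h1 := congr_fun hb (γ.toContinuousMap.comp h)
  rw [coboundary_zero_apply] at h1
  have h2 : ((charCocycle c u : cocycles₁ X) : Cochain 1 X) (γ.toContinuousMap.comp h) =
      u (.ofMul ((Homotopic.Quotient.mk γ).based c)) := by
    simp only [charCocycle, LinearMap.coe_mk, AddHom.coe_mk, Homotopic.Quotient.edgeLoop_comp]
    rw [← Homotopic.Quotient.edgeLoop_path]
    rfl
  have hface : ∀ i, (γ.toContinuousMap.comp h).comp (faceMap 0 i) =
      ContinuousMap.const (stdSimplex ℝ (Fin 1)) x₀ := by
    intro i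
    ext p
    rw [Subsingleton.elim p (stdSimplex.vertex 0)]
    simp only [ContinuousMap.comp_apply, faceMap_vertex, ContinuousMap.const_apply]
    fin_cases i
    · exact γ.target
    · exact γ.source
  rw [hface, hface, sub_self] at h1
  exact (h1.trans h2).symm

theorem pullback_charClass (φ : X ≃ₜ X) (δ : Path x₀ (φ x₀))
    (u v : Additive (FundamentalGroup X x₀) →+ ℝ)
    (huv : ∀ g, v (.ofMul g) = u (.ofMul (FundamentalGroup.mapAut φ δ g))) :
    pullback (φ : C(X, X)) (charClass c u) = charClass c v := by
  let e : X → FundamentalGroup X x₀ := fun y =>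
    ((Homotopic.Quotient.mk δ).trans ((Homotopic.Quotient.mk (c y)).map (φ : C(X, X)))).trans
      (Homotopic.Quotient.mk (c (φ y))).symm
  have key : ∀ {y z : X} (η : Homotopic.Quotient y z),
      v (.ofMul (η.based c)) = u (.ofMul ((η.map (φ : C(X, X))).based c))
        + u (.ofMul (e y)) - u (.ofMul (e z)) := by
    intro y z η
    have h : e z * FundamentalGroup.mapAut φ δ (η.based c) =
        (η.map (φ : C(X, X))).based c * e y := by
      rw [FundamentalGroup.mapAut_apply]
      simp only [e, Homotopic.Quotient.based, Homotopic.Quotient.map_trans,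
        Homotopic.Quotient.map_symm, FundamentalGroup.mul_def, Homotopic.Quotient.trans_assoc]
      congr 2
      simp only [ContinuousMap.coe_coe, Homotopic.Quotient.symm_trans_cancel]
    have h' := congr_arg (fun g => u (.ofMul g)) h
    simp only [ofMul_mul, map_add] at h'
    rw [huv]
    linarith
  refine (Submodule.Quotient.eq _).2 ⟨fun s => u (.ofMul (e (s (stdSimplex.vertex 0)))), ?_⟩
  funext s
  have h1 : v (.ofMul (Homotopic.Quotient.edgeLoop c s (stdSimplex.vertex 0)
    (stdSimplex.vertex 1))) = _ := key _
  rw [← Homotopic.Quotient.map_comp] at h1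
  rw [coboundary_zero_apply]
  simp only [ContinuousMap.comp_apply, faceMap_vertex]
  change u (.ofMul (e (s (stdSimplex.vertex (1 : Fin 2))))) -
    u (.ofMul (e (s (stdSimplex.vertex (0 : Fin 2))))) =
      u (.ofMul (Homotopic.Quotient.edgeLoop c ((φ : C(X, X)).comp s) (stdSimplex.vertex 0)
        (stdSimplex.vertex 1))) - v (.ofMul (Homotopic.Quotient.edgeLoop c s (stdSimplex.vertex 0)
          (stdSimplex.vertex 1)))
  rw [h1, Homotopic.Quotient.edgeLoop]
  ring

end SingularCohomology

end

noncomputable section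

namespace MappingTorus

variable {S : Type*} [TopologicalSpace S] (φ : S ≃ₜ S)

/-- The homotopy, along the interval direction, from the inclusion of the fiber to its composition
with the monodromy. -/
def fiberHomotopy : (fiberIncl φ).Homotopy ((fiberIncl φ).comp (φ : C(S, S))) where
  toFun p := Quot.mk _ (p.2, p.1)
  continuous_toFun := continuous_quot_mk.comp (by fun_prop)
  map_zero_left _ := rfl
  map_one_left _ := Quot.sound ⟨rfl, rfl, rfl⟩

open Path in
/-- The monodromy acts on the fiber group as conjugation by an element of the fundamental group of
the mapping torus. -/
theorem exists_conj_fiberGroup {x₀ : S} (δ : Path x₀ (φ x₀)) :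
    ∃ t : FundamentalGroup (MappingTorus φ) (fiberIncl φ x₀), ∀ γ : FundamentalGroup S x₀,
      t * FundamentalGroup.map (fiberIncl φ) x₀ γ * t⁻¹ =
        FundamentalGroup.map (fiberIncl φ) x₀ (FundamentalGroup.mapAut φ δ γ) := by
  let τ := Homotopic.Quotient.mk ((fiberHomotopy φ).evalAt x₀)
  let η := (Homotopic.Quotient.mk δ).map (fiberIncl φ)
  refine ⟨τ.trans η.symm, fun γ => ?_⟩
  obtain ⟨p, rfl⟩ := Homotopic.Quotient.mk_surjective γ
  have h : ((Homotopic.Quotient.mk p).map (fiberIncl φ)).trans τ =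
      τ.trans (((Homotopic.Quotient.mk p).map (φ : C(S, S))).map (fiberIncl φ)) :=
    Homotopic.Quotient.eq.2 (Homotopic.map_trans_evalAt (fiberHomotopy φ) p)
  rw [mul_inv_eq_iff_eq_mul, FundamentalGroup.mapAut_apply]
  change ((Homotopic.Quotient.mk p).map (fiberIncl φ)).trans (τ.trans η.symm) =
    (τ.trans η.symm).trans (Homotopic.Quotient.map (((Homotopic.Quotient.mk δ).trans
      ((Homotopic.Quotient.mk p).map (φ : C(S, S)))).trans (Homotopic.Quotient.mk δ).symm)
        (fiberIncl φ))
  rw [← Homotopic.Quotient.trans_assoc, h]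
  simp only [Homotopic.Quotient.map_trans, Homotopic.Quotient.map_symm,
    Homotopic.Quotient.trans_assoc]
  congr 1
  exact (Homotopic.Quotient.symm_trans_cancel _ _).symm

end MappingTorus

/-- A two-dimensional real rotation-dilation block of a linear map gives a complex eigenvalue. -/
theorem LinearMap.hasEigenvalue_baseChange_complex {V : Type*} [AddCommGroup V] [Module ℝ V]
    (B : V →ₗ[ℝ] V) {a b : V} (hab : a ≠ 0 ∨ b ≠ 0) (z : ℂ) (ha : B a = z.re • a - z.im • b)
    (hb : B b = z.im • a + z.re • b) :
    Module.End.HasEigenvalue (LinearMap.baseChange ℂ B : Module.End ℂ (ℂ ⊗[ℝ] V)) z := by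
  refine Module.End.hasEigenvalue_of_hasEigenvector
    (x := (1 : ℂ) ⊗ₜ[ℝ] a + Complex.I ⊗ₜ[ℝ] b) ⟨?_, ?_⟩
  · rw [Module.End.mem_eigenspace_iff, map_add, LinearMap.baseChange_tmul,
      LinearMap.baseChange_tmul, ha, hb, smul_add, TensorProduct.smul_tmul',
      TensorProduct.smul_tmul']
    have h1 : z • (1 : ℂ) = z.re • (1 : ℂ) + z.im • Complex.I := by
      apply Complex.ext <;> simp
    have h2 : z • Complex.I = z.re • Complex.I - z.im • (1 : ℂ) := by
      apply Complex.ext <;> simp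
    rw [h1, h2]
    simp only [TensorProduct.tmul_add, TensorProduct.tmul_sub, TensorProduct.add_tmul,
      TensorProduct.sub_tmul, TensorProduct.tmul_smul, TensorProduct.smul_tmul]
    abel
  · intro h
    have h1 := congr_arg (TensorProduct.lid ℝ V ∘ LinearMap.rTensor V Complex.reLm) h
    have h2 := congr_arg (TensorProduct.lid ℝ V ∘ LinearMap.rTensor V Complex.imLm) h
    simp at h1 h2
    exact hab.elim (· h1) (· h2)

/-- A complex-valued character of the fundamental group on which the monodromy acts by a scalar
gives an eigenvalue of the induced map in cohomology. -/
theorem SingularCohomology.hasEigenvalue_pullback {X : Type*} [TopologicalSpace X]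
    [PathConnectedSpace X] {x₀ : X} (φ : X ≃ₜ X) (δ : Path x₀ (φ x₀))
    (f : Additive (FundamentalGroup X x₀) →+ ℂ) (hf : f ≠ 0) (z : ℂ)
    (hz : ∀ g, f (.ofMul (FundamentalGroup.mapAut φ δ g)) = z * f (.ofMul g)) :
    Module.End.HasEigenvalue
      (LinearMap.baseChange ℂ (pullback (φ : C(X, X))) : Module.End ℂ (ℂ ⊗[ℝ] H1 X)) z := by
  let c : ∀ y, Path x₀ y := PathConnectedSpace.somePath x₀
  let u : Additive (FundamentalGroup X x₀) →+ ℝ := Complex.reAddGroupHom.comp f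
  let v : Additive (FundamentalGroup X x₀) →+ ℝ := Complex.imAddGroupHom.comp f
  refine LinearMap.hasEigenvalue_baseChange_complex _ (a := charClass c u) (b := charClass c v)
    ?_ z ?_ ?_
  · by_contra! h
    have hu := charClass_injective c (h.1.trans (map_zero _).symm)
    have hv := charClass_injective c (h.2.trans (map_zero _).symm)
    refine hf (AddMonoidHom.ext fun g => Complex.ext ?_ ?_)
    · exact DFunLike.congr_fun hu g
    · exact DFunLike.congr_fun hv g
  · rw [← map_smul, ← map_smul, ← map_sub]
    refine pullback_charClass c φ δ u _ fun g => ?_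
    simp [u, v, hz]
  · rw [← map_smul, ← map_smul, ← map_add]
    refine pullback_charClass c φ δ v _ fun g => ?_
    simp [u, v, hz]
    ring

end

noncomputable section

section BoundedCharacters

variable {Γ : Type*} [Group Γ]

theorem AddMonoidHom.eq_zero_of_closure_eq_top {V : Type*} [AddCommGroup V] {A : Set Γ}
    (hA : Subgroup.closure A = ⊤) (f : Additive Γ →+ V) (hf : ∀ a ∈ A, f (.ofMul a) = 0) :
    f = 0 := by
  refine AddMonoidHom.ext fun g => ?_
  obtain ⟨g, rfl⟩ := Additive.ofMul.surjective g
  have hg : g ∈ Subgroup.closure A := hA ▸ Subgroup.mem_top _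
  rw [AddMonoidHom.zero_apply]
  induction hg using Subgroup.closure_induction with
  | mem a ha => exact hf a ha
  | one => rw [ofMul_one, map_zero]
  | mul a b _ _ ha hb => rw [ofMul_mul, map_add, ha, hb, add_zero]
  | inv a _ ha => rw [ofMul_inv, map_neg, ha, neg_zero]

/-- The space of complex characters that are bounded along the orbits of `A` under `α`. -/
def boundedCharacters (A : Set Γ) (α : MulAut Γ) : Submodule ℂ (Additive Γ →+ ℂ) where
  carrier := {f | ∃ C : ℝ, ∀ k : ℤ, ∀ a ∈ A, ‖f (.ofMul ((α ^ k) a))‖ ≤ C}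
  zero_mem' := ⟨0, by simp⟩
  add_mem' := by
    rintro f g ⟨C, hC⟩ ⟨C', hC'⟩
    exact ⟨C + C', fun k a ha => (norm_add_le _ _).trans (add_le_add (hC k a ha) (hC' k a ha))⟩
  smul_mem' := by
    rintro z f ⟨C, hC⟩
    refine ⟨‖z‖ * C, fun k a ha => ?_⟩
    rw [AddMonoidHom.smul_apply, norm_smul]
    exact mul_le_mul_of_nonneg_left (hC k a ha) (norm_nonneg z)

/-- Precomposition with `α` on the characters bounded along its orbits. -/
def boundedCharacters.precomp (A : Set Γ) (α : MulAut Γ) :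
    boundedCharacters A α →ₗ[ℂ] boundedCharacters A α where
  toFun f := ⟨f.1.comp (MonoidHom.toAdditive α.toMonoidHom), by
    obtain ⟨C, hC⟩ := f.2
    refine ⟨C, fun k a ha => ?_⟩
    have h := hC (1 + k) a ha
    rw [zpow_one_add] at h
    exact h⟩
  map_add' _ _ := rfl
  map_smul' _ _ := rfl

/-- If an automorphism of a finitely generated group has a nonzero character with bounded full
orbit, then it acts on some nonzero character by a scalar of modulus one. -/
theorem exists_character_norm_eq_one {A : Set Γ} (hAf : A.Finite)
    (hA : Subgroup.closure A = ⊤) (α : MulAut Γ) (D : Additive Γ →+ ℂ) (hD : D ≠ 0)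
    (C : ℝ) (hC : ∀ k : ℤ, ∀ a ∈ A, ‖D (.ofMul ((α ^ k) a))‖ ≤ C) :
    ∃ (f : Additive Γ →+ ℂ) (z : ℂ), f ≠ 0 ∧ ‖z‖ = 1 ∧
      ∀ g, f (.ofMul (α g)) = z * f (.ofMul g) := by
  have : Finite A := hAf
  let ev : boundedCharacters A α →ₗ[ℂ] (A → ℂ) :=
    { toFun := fun f a => f.1 (.ofMul a.1)
      map_add' := fun _ _ => rfl
      map_smul' := fun _ _ => rfl }
  have hev : Function.Injective ev := by
    rw [injective_iff_map_eq_zero]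
    exact fun f hf => Subtype.ext (f.1.eq_zero_of_closure_eq_top hA fun a ha => congr_fun hf ⟨a, ha⟩)
  have : FiniteDimensional ℂ (boundedCharacters A α) := FiniteDimensional.of_injective ev hev
  have : Nontrivial (boundedCharacters A α) :=
    ⟨⟨⟨D, C, hC⟩, 0, fun h => hD (congr_arg Subtype.val h)⟩⟩
  obtain ⟨z, hz⟩ := Module.End.exists_eigenvalue (boundedCharacters.precomp A α)
  obtain ⟨⟨f, C', hC'⟩, hf⟩ := hz.exists_hasEigenvector
  have hf0 : f ≠ 0 := fun h => hf.2 (Subtype.ext h)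
  have hfz : ∀ g, f (.ofMul (α g)) = z * f (.ofMul g) := fun g =>
    DFunLike.congr_fun (congr_arg Subtype.val hf.apply_eq_smul) (.ofMul g)
  refine ⟨f, z, hf0, ?_, hfz⟩
  have hpow : ∀ (n : ℕ) g, f (.ofMul ((α ^ n) g)) = z ^ n * f (.ofMul g) := by
    intro n
    induction n with
    | zero => simp
    | succ n ih =>
      intro g
      rw [pow_succ', MulAut.mul_apply, hfz, ih, pow_succ', mul_assoc]
  obtain ⟨a, ha, hfa⟩ : ∃ a ∈ A, f (.ofMul a) ≠ 0 := by
    by_contra! h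
    exact hf0 (f.eq_zero_of_closure_eq_top hA h)
  have hfa' : 0 < ‖f (.ofMul a)‖ := norm_pos_iff.2 hfa
  refine le_antisymm ?_ ?_
  · by_contra! h
    obtain ⟨n, hn⟩ := pow_unbounded_of_one_lt (C' / ‖f (.ofMul a)‖) h
    have h1 := hC' n a ha
    rw [zpow_natCast, hpow, norm_mul, norm_pow] at h1
    rw [div_lt_iff₀ hfa'] at hn
    linarith
  · by_contra! h
    have hC0 : 0 ≤ C' := (norm_nonneg _).trans (hC' 0 a ha)
    obtain ⟨n, hn⟩ := exists_pow_lt_of_lt_one (y := ‖z‖) (div_pos hfa' (by linarith : 0 < C' + 1)) h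
    have h1 := hC' (-n) a ha
    have h2 := hpow n ((α ^ (-(n : ℤ))) a)
    rw [← zpow_natCast, ← MulAut.mul_apply, ← zpow_add, add_neg_cancel, zpow_zero,
      MulAut.one_apply] at h2
    have h3 : ‖f (.ofMul a)‖ ≤ ‖z‖ ^ n * C' := by
      rw [h2, norm_mul, norm_pow]
      exact mul_le_mul_of_nonneg_left h1 (by positivity)
    rw [lt_div_iff₀ (by linarith)] at hn
    nlinarith [pow_nonneg (norm_nonneg z) n]

end BoundedCharacters

/-- Conjugation by powers of `t` realizes the powers of `α`. -/
theorem map_zpow_mulAut_apply {Γ G : Type*} [Group Γ] [Group G] (j : Γ →* G) (t : G)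
    (α : MulAut Γ) (h : ∀ γ, t * j γ * t⁻¹ = j (α γ)) (k : ℤ) (γ : Γ) :
    j ((α ^ k) γ) = t ^ k * j γ * (t ^ k)⁻¹ := by
  induction k generalizing γ with
  | zero => simp
  | succ n ih =>
    rw [zpow_add_one, MulAut.mul_apply, ih, ← h]
    group
  | pred n ih =>
    have h' : j (α⁻¹ γ) = t⁻¹ * j γ * t := by
      have := h (α⁻¹ γ)
      rw [MulAut.apply_inv_self] at this
      rw [← this]
      group
    rw [zpow_sub_one, MulAut.mul_apply, ih, h']
    group

section Displacement

variable {Γ G R X E : Type*} [Group Γ] [Group G] [NormedAddCommGroup E] [NormedSpace ℝ E]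

/-- Rescaled limits of displacements: if the actions `ρ r` of `G` have displacements with Lipschitz
constants tending to zero but `j(Γ)` acts non-trivially, then there is a nonzero homomorphism from
`Γ` to `E` that is bounded along the orbits of the generators under `α`. -/
theorem exists_character_of_displacement [FiniteDimensional ℝ E] [TopologicalSpace X]
    [CompactSpace X] (𝓕 : Filter R) [𝓕.NeBot] (ρ : R → G → X → X)
    (hone : ∀ r x, ρ r 1 x = x) (hmul : ∀ r g h x, ρ r (g * h) x = ρ r g (ρ r h x))
    (e : X → E) (he : Continuous e) (hρ : ∀ r g, Continuous (ρ r g))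
    (hlip : ∀ g, ∀ ε > 0, ∀ᶠ r in 𝓕, ∀ x y,
      ‖(e (ρ r g x) - e x) - (e (ρ r g y) - e y)‖ ≤ ε * ‖e x - e y‖)
    (j : Γ →* G) (t : G) (α : MulAut Γ) (hα : ∀ γ, t * j γ * t⁻¹ = j (α γ))
    {A : Set Γ} (hAf : A.Finite) (hA : Subgroup.closure A = ⊤)
    (hbad : ∀ᶠ r in 𝓕, ∃ a ∈ A, ∃ x, e (ρ r (j a) x) ≠ e x) :
    ∃ D : Additive Γ →+ E, D ≠ 0 ∧ ∀ k : ℤ, ∀ a ∈ A, ‖D (.ofMul ((α ^ k) a))‖ ≤ 2 := by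
  let Δ : R → Γ → X → E := fun r γ x => e (ρ r (j γ) x) - e x
  have hΔ1 : ∀ r x, Δ r 1 x = 0 := fun r x => by simp [Δ, hone]
  have hΔmul : ∀ r g h x, Δ r (g * h) x = Δ r g (ρ r (j h) x) + Δ r h x := fun r g h x => by
    simp [Δ, hmul]
  have hΔinv : ∀ r g x, Δ r g⁻¹ x = - Δ r g (ρ r (j g⁻¹) x) := fun r g x => by
    rw [eq_neg_iff_add_eq_zero, add_comm, ← hΔmul, mul_inv_cancel, hΔ1]
  have hΔc : ∀ r g, Continuous (Δ r g) := fun r g => (he.comp (hρ r _)).sub he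
  have hmax : ∀ᶠ r in 𝓕, ∃ p : ℝ × X, 0 < p.1 ∧ (∀ a ∈ A, ∀ y, ‖Δ r a y‖ ≤ p.1) ∧
      ∃ a ∈ A, ‖Δ r a p.2‖ = p.1 := by
    filter_upwards [hbad] with r hr
    obtain ⟨a₀, ha₀, x₀, hx₀⟩ := hr
    have hm : ∀ a ∈ A, ∃ x, ∀ y, ‖Δ r a y‖ ≤ ‖Δ r a x‖ := fun a _ => by
      obtain ⟨x, -, hx⟩ := isCompact_univ.exists_isMaxOn ⟨x₀, mem_univ _⟩
        (hΔc r a).norm.continuousOn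
      exact ⟨x, fun y => hx (mem_univ y)⟩
    have : Nonempty X := ⟨x₀⟩
    choose! x hx using hm
    obtain ⟨a, ha, hmx⟩ := hAf.exists_maximalFor (fun a => ‖Δ r a (x a)‖) A ⟨a₀, ha₀⟩
    have hle : ∀ b ∈ A, ∀ y, ‖Δ r b y‖ ≤ ‖Δ r a (x a)‖ := fun b hb y =>
      (hx b hb y).trans ((le_total _ _).elim id fun h => hmx hb h)
    refine ⟨(‖Δ r a (x a)‖, x a), ?_, hle, a, ha, rfl⟩
    exact (norm_pos_iff.2 (sub_ne_zero.2 hx₀)).trans_le (hle a₀ ha₀ x₀)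
  have : Nonempty (ℝ × X) := by
    obtain ⟨r, p, -⟩ := hmax.exists
    exact ⟨p⟩
  obtain ⟨p, hp⟩ := hmax.choice
  have hbound : ∀ g : Γ, ∃ C : ℝ, ∀ r, 0 < (p r).1 → (∀ a ∈ A, ∀ y, ‖Δ r a y‖ ≤ (p r).1) →
      ∀ y, ‖Δ r g y‖ ≤ C * (p r).1 := by
    intro g
    have hg : g ∈ Subgroup.closure A := hA ▸ Subgroup.mem_top _
    induction hg using Subgroup.closure_induction with
    | mem a ha => exact ⟨1, fun r _ hr y => by simpa using hr a ha y⟩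
    | one => exact ⟨0, fun r _ _ y => by simp [hΔ1]⟩
    | mul g h _ _ ihg ihh =>
      obtain ⟨C, hC⟩ := ihg
      obtain ⟨C', hC'⟩ := ihh
      refine ⟨C + C', fun r h0 hr y => ?_⟩
      rw [hΔmul, add_mul]
      exact (norm_add_le _ _).trans (add_le_add (hC r h0 hr _) (hC' r h0 hr _))
    | inv g _ ih =>
      obtain ⟨C, hC⟩ := ih
      refine ⟨C, fun r h0 hr y => ?_⟩
      rw [hΔinv, norm_neg]
      exact hC r h0 hr _
  choose C hC using hbound
  let 𝓤 : Ultrafilter R := Ultrafilter.of 𝓕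
  have h𝓤 : (𝓤 : Filter R) ≤ 𝓕 := Ultrafilter.of_le 𝓕
  let d : R → Γ → E := fun r g => (p r).1⁻¹ • Δ r g (p r).2
  have hnorm : ∀ {r : R} {c : ℝ} {v : E}, 0 < (p r).1 → ‖v‖ ≤ c * (p r).1 →
      ‖(p r).1⁻¹ • v‖ ≤ c := by
    intro r c v h0 hv
    rw [norm_smul, norm_inv, Real.norm_of_nonneg h0.le, inv_mul_le_iff₀ h0, mul_comm]
    exact hv
  have hlim : ∀ g, ∃ v, Filter.Tendsto (fun r => d r g) 𝓤 (𝓝 v) := by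
    intro g
    have hcpt : IsCompact (Metric.closedBall (0 : E) (C g)) :=
      have := FiniteDimensional.proper_real E
      isCompact_closedBall _ _
    obtain ⟨v, -, hv⟩ := hcpt.ultrafilter_le_nhds (𝓤.map fun r => d r g) (by
      rw [Filter.le_principal_iff, Ultrafilter.mem_coe, Ultrafilter.mem_map]
      filter_upwards [h𝓤 hp] with r hr
      rw [mem_preimage, mem_closedBall_zero_iff]
      exact hnorm hr.1 (hC g r hr.1 hr.2.1 _))
    exact ⟨v, hv⟩
  choose D hD using hlim
  have hadd : ∀ g h, D (g * h) = D g + D h := by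
    intro g h
    have h0 : Filter.Tendsto (fun r => d r (g * h) - (d r g + d r h)) 𝓤 (𝓝 0) := by
      rw [NormedAddGroup.tendsto_nhds_zero]
      intro ε hε
      have hε' : 0 < ε / (2 * (|C h| + 1)) := by positivity
      filter_upwards [h𝓤 hp, h𝓤 (hlip (j g) _ hε')] with r hr hl
      rw [← smul_add, ← smul_sub]
      refine (hnorm hr.1 (c := ε / 2) ?_).trans_lt (half_lt_self hε)
      rw [hΔmul, add_sub_add_right_eq_sub]
      refine (hl _ _).trans ?_
      have h1 := hC h r hr.1 hr.2.1 (p r).2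
      have h2 : ‖Δ r h (p r).2‖ ≤ (|C h| + 1) * (p r).1 :=
        h1.trans (mul_le_mul_of_nonneg_right (by linarith [le_abs_self (C h)]) hr.1.le)
      refine (mul_le_mul_of_nonneg_left h2 hε'.le).trans (le_of_eq ?_)
      field_simp
    have h1 := tendsto_nhds_unique h0 ((hD (g * h)).sub ((hD g).add (hD h)))
    exact (sub_eq_zero.1 h1.symm)
  refine ⟨AddMonoidHom.mk' (fun g => D g.toMul) fun g h => hadd _ _, ?_, ?_⟩
  · intro hzero
    have hD0 : ∀ g, D g = 0 := fun g => DFunLike.congr_fun hzero (.ofMul g)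
    have hsmall : ∀ᶠ r in (𝓤 : Filter R), ∀ a ∈ A, ‖d r a‖ < 1 := by
      rw [Filter.eventually_all_finite hAf]
      intro a _
      have := hD a
      rw [hD0] at this
      exact NormedAddGroup.tendsto_nhds_zero.1 this 1 one_pos
    obtain ⟨r, hr, h0, -, a, ha, hra⟩ := (hsmall.and (h𝓤 hp)).exists
    have h1 := hr a ha
    rw [norm_smul, hra, norm_inv, Real.norm_of_nonneg h0.le, inv_mul_cancel₀ h0.ne'] at h1
    exact lt_irrefl _ h1
  · intro k a ha
    refine le_of_tendsto (hD _).norm ?_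
    filter_upwards [h𝓤 hp, h𝓤 (hlip (t ^ k) 1 one_pos)] with r hr hl
    refine hnorm hr.1 ?_
    set y := ρ r (t ^ k)⁻¹ (p r).2
    have hy : ρ r (t ^ k) y = (p r).2 := by rw [← hmul, mul_inv_cancel, hone]
    have h1 : Δ r ((α ^ k) a) (p r).2 = ((e (ρ r (t ^ k) (ρ r (j a) y)) - e (ρ r (j a) y)) -
        (e (ρ r (t ^ k) y) - e y)) + Δ r a y := by
      simp only [Δ, map_zpow_mulAut_apply j t α hα, hmul, hy]
      abel
    rw [toMul_ofMul, h1]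
    have h2 := hl (ρ r (j a) y) y
    have h3 := hr.2.1 a ha y
    calc _ ≤ 1 * ‖Δ r a y‖ + ‖Δ r a y‖ := (norm_add_le _ _).trans (add_le_add_left h2 _)
      _ ≤ 2 * (p r).1 := by linarith

end Displacement

end

noncomputable section

/-- Near a point of a convex set at which a `C¹` map `F` is immersive, a map whose derivative is
dominated by that of `F` is Lipschitz with respect to the distances measured through `F`. -/
theorem Convex.exists_norm_sub_le_of_injective_fderivWithin {E V : Type*} [NormedAddCommGroup E]
    [NormedSpace ℝ E] [FiniteDimensional ℝ E] [NormedAddCommGroup V] [NormedSpace ℝ V] {s : Set E}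
    (hs : Convex ℝ s) {F : E → V} {u₀ : E}
    {T : Set E} (hT : T ∈ 𝓝[s] u₀) (hF : ∀ u ∈ T, DifferentiableWithinAt ℝ F s u)
    (hF' : ContinuousWithinAt (fderivWithin ℝ F s) s u₀)
    (hinj : Function.Injective (fderivWithin ℝ F s u₀)) :
    ∃ B ∈ 𝓝[s] u₀, B ⊆ T ∧ ∃ K : ℝ, 0 ≤ K ∧ ∀ δ : ℝ, 0 ≤ δ → ∀ (g : E → V) (g' : E → E →L[ℝ] V),
      (∀ u ∈ B, HasFDerivWithinAt g (g' u) s u) →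
      (∀ u ∈ B, ∀ w, ‖g' u w‖ ≤ δ * ‖fderivWithin ℝ F s u w‖) →
      ∀ u ∈ B, ∀ v ∈ B, ‖g u - g v‖ ≤ K * δ * ‖F u - F v‖ := by
  set L := fderivWithin ℝ F s u₀
  obtain ⟨k, hk, hanti⟩ := (L : E →ₗ[ℝ] V).exists_antilipschitzWith (LinearMap.ker_eq_bot.2 hinj)
  have hk' : (0 : ℝ) < k := hk
  have hclose : ∀ᶠ u in 𝓝[s] u₀, ‖fderivWithin ℝ F s u - L‖ < 1 / (2 * k) := by
    have := Metric.continuousWithinAt_iff'.1 hF' (1 / (2 * k)) (by positivity)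
    simpa only [dist_eq_norm] using this
  obtain ⟨r, hr, hB⟩ := Metric.mem_nhdsWithin_iff.1 (Filter.inter_mem hT hclose)
  have hconv : Convex ℝ (Metric.ball u₀ r ∩ s) := (convex_ball _ _).inter hs
  have hlow : ∀ u ∈ Metric.ball u₀ r ∩ s, ∀ v ∈ Metric.ball u₀ r ∩ s,
      ‖u - v‖ ≤ 2 * k * ‖F u - F v‖ := by
    intro u hu v hv
    have h1 := hconv.norm_image_sub_le_of_norm_hasFDerivWithin_le
      (f := fun u => F u - L u) (f' := fun u => fderivWithin ℝ F s u - L) (C := 1 / (2 * k))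
      (fun w hw => ((hF w (hB hw).1).hasFDerivWithinAt.mono inter_subset_right).sub
        L.hasFDerivWithinAt) (fun w hw => (hB hw).2.le) hv hu
    have h2 : ‖u - v‖ ≤ k * ‖L u - L v‖ := by
      simpa [dist_eq_norm] using hanti.le_mul_dist u v
    have h3 : ‖L u - L v‖ ≤ ‖F u - F v‖ + 1 / (2 * k) * ‖u - v‖ := by
      refine le_trans ?_ (add_le_add_right h1 _)
      rw [show L u - L v = (F u - F v) - (F u - L u - (F v - L v)) by abel]
      exact norm_sub_le _ _
    have h4 : k * ‖L u - L v‖ ≤ k * ‖F u - F v‖ + ‖u - v‖ / 2 := by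
      refine (mul_le_mul_of_nonneg_left h3 hk'.le).trans (le_of_eq ?_)
      field_simp
    linarith
  refine ⟨Metric.ball u₀ r ∩ s, Filter.inter_mem (mem_nhdsWithin_of_mem_nhds
    (Metric.ball_mem_nhds _ hr)) self_mem_nhdsWithin, fun u hu => (hB hu).1, (‖L‖ + 1 / (2 * k)) * (2 * k),
    by positivity, ?_⟩
  intro δ hδ g g' hg hg' u hu v hv
  have hbd : ∀ w ∈ Metric.ball u₀ r ∩ s, ‖g' w‖ ≤ δ * (‖L‖ + 1 / (2 * k)) := by
    intro w hw
    refine ContinuousLinearMap.opNorm_le_bound _ (by positivity) fun a => ?_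
    refine (hg' w hw a).trans ?_
    rw [mul_assoc]
    refine mul_le_mul_of_nonneg_left ?_ hδ
    refine (ContinuousLinearMap.le_opNorm _ a).trans (mul_le_mul_of_nonneg_right ?_ (norm_nonneg a))
    have := norm_sub_norm_le (fderivWithin ℝ F s w) L
    have hcl : ‖fderivWithin ℝ F s w - L‖ < 1 / (2 * k) := (hB hw).2
    linarith
  have h1 := hconv.norm_image_sub_le_of_norm_hasFDerivWithin_le
    (fun w hw => (hg w hw).mono inter_subset_right) hbd hv hu
  refine h1.trans ((mul_le_mul_of_nonneg_left (hlow u hu v hv) (by positivity)).trans (le_of_eq ?_))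
  ring

section Diff

variable {E : Type*} [NormedAddCommGroup E] [NormedSpace ℝ E] {H : Type*} [TopologicalSpace H]
  {I : ModelWithCorners ℝ E H} {M : Type*} [TopologicalSpace M] [ChartedSpace H M]
  {N : ℕ} {e : M → EuclideanSpace ℝ (Fin N)}

/-- `f` is `C¹`-close to the identity, up to `δ`, when measured through `e`. -/
def Diff1.IsClose (I : ModelWithCorners ℝ E H) (e : M → EuclideanSpace ℝ (Fin N)) (δ : ℝ)
    (f : Diff1 I M) : Prop :=
  (∀ x, ‖e (f x) - e x‖ ≤ δ) ∧ ∀ (x : M) (v : TangentSpace I x),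
    ‖ambientDeriv I (e ∘ f) x v - ambientDeriv I e x v‖ ≤ δ * ‖ambientDeriv I e x v‖

theorem Diff1.eventually_isClose (he : IsC1Embedding I e) {δ : ℝ} (hδ : 0 < δ) :
    ∀ᶠ f in 𝓝 (1 : Diff1 I M), Diff1.IsClose I e δ f := by
  have hle : (Diff1.instTopologicalSpace I : TopologicalSpace (Diff1 I M)) ≤
      (c1PseudoEMetric I e).toUniformSpace.toTopologicalSpace :=
    iInf_le_of_le N (iInf_le_of_le e (iInf_le _ he))
  refine nhds_mono hle ?_
  let := c1PseudoEMetric I e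
  refine Filter.mem_of_superset (Metric.eball_mem_nhds (1 : Diff1 I M) (ENNReal.ofReal_pos.2 hδ)) ?_
  intro f hf
  have hf' : c1EDist I e f 1 < ENNReal.ofReal δ := hf
  refine ⟨fun x => ?_, fun x v => ?_⟩
  · have h1 : edist (e (f x)) (e x) ≤ ENNReal.ofReal δ :=
      ((le_iSup (fun x => edist (e (f x)) (e ((1 : Diff1 I M) x))) x).trans le_self_add).trans hf'.le
    rwa [edist_dist, ENNReal.ofReal_le_ofReal_iff hδ.le, dist_eq_norm] at h1
  · have h1 : ∀ w : TangentSpace I x, ‖ambientDeriv I e x w‖ ≤ 1 →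
        ‖ambientDeriv I (e ∘ f) x w - ambientDeriv I e x w‖ ≤ δ := by
      intro w hw
      have h2 : edist (ambientDeriv I (e ∘ f) x w) (ambientDeriv I e x w) ≤ ENNReal.ofReal δ :=
        (le_trans (le_iSup_of_le x (le_iSup_of_le w (le_iSup
          (fun _ : ‖ambientDeriv I e x w‖ ≤ 1 => edist (ambientDeriv I (e ∘ f) x w)
            (ambientDeriv I (e ∘ (1 : Diff1 I M)) x w)) hw)))
          (le_add_self (b := ⨆ x : M, edist (e (f x)) (e ((1 : Diff1 I M) x))))).trans hf'.le
      rwa [edist_dist, ENNReal.ofReal_le_ofReal_iff hδ.le, dist_eq_norm] at h2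
    by_cases hv : ambientDeriv I e x v = 0
    · have hv0 : v = 0 := he.injective_mfderiv x (hv.trans (map_zero (ambientDeriv I e x)).symm)
      simp [hv0]
    · have hc : 0 < ‖ambientDeriv I e x v‖ := norm_pos_iff.2 hv
      have h2 := h1 (‖ambientDeriv I e x v‖⁻¹ • v) (by
        rw [map_smul, norm_smul, norm_inv, norm_norm, inv_mul_cancel₀ hc.ne'])
      rw [map_smul, map_smul, ← smul_sub, norm_smul, norm_inv, norm_norm,
        inv_mul_le_iff₀ hc] at h2
      rwa [mul_comm]

/-- Locally around a point, displacements of diffeomorphisms that are `C¹`-close to the identity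
are Lipschitz with small constants. -/
theorem Diff1.exists_lipschitz_displacement_nhds [FiniteDimensional ℝ E] [IsManifold I 1 M]
    (he : IsC1Embedding I e) (p : M) :
    ∃ W ∈ 𝓝 p, ∃ K : ℝ, 0 ≤ K ∧ ∀ δ : ℝ, 0 ≤ δ → ∀ f : Diff1 I M, Diff1.IsClose I e δ f →
      ∀ x ∈ W, ∀ y ∈ W, ‖(e (f x) - e x) - (e (f y) - e y)‖ ≤ K * δ * ‖e x - e y‖ := by
  let ψ := (extChartAt I p).symm
  let s := range I
  let u₀ := extChartAt I p p
  have hu₀ : u₀ ∈ (extChartAt I p).target := mem_extChartAt_target p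
  have hts : (extChartAt I p).target ⊆ s := extChartAt_target_subset_range p
  let D : (M → EuclideanSpace ℝ (Fin N)) → E → E →L[ℝ] EuclideanSpace ℝ (Fin N) := fun h u =>
    (ambientDeriv I h (ψ u)).comp (mfderivWithin 𝓘(ℝ, E) I ψ s u)
  have hchain : ∀ h : M → EuclideanSpace ℝ (Fin N), ContMDiff I 𝓘(ℝ, EuclideanSpace ℝ (Fin N)) 1 h →
      ∀ u ∈ (extChartAt I p).target, HasFDerivWithinAt (h ∘ ψ) (D h u) s u := by
    intro h hh u hu
    have h1 := (hh.mdifferentiableAt (x := ψ u) one_ne_zero).hasMFDerivAt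
    have h2 := (mdifferentiableWithinAt_extChartAt_symm (I := I) hu).hasMFDerivWithinAt
    exact (h1.comp_hasMFDerivWithinAt u h2).hasFDerivWithinAt
  have hfd : ∀ u ∈ (extChartAt I p).target, fderivWithin ℝ (e ∘ ψ) s u = D e u := fun u hu =>
    (hchain e he.contMDiff u hu).fderivWithin (I.uniqueDiffOn u (hts hu))
  have hmem : (extChartAt I p).target ∈ 𝓝[s] u₀ := extChartAt_target_mem_nhdsWithin p
  have hcd : ContDiffWithinAt ℝ 1 (e ∘ ψ) s u₀ := by
    have h1 := he.contMDiff.comp_contMDiffOn (contMDiffOn_extChartAt_symm (I := I) (n := 1) p)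
    exact ((contMDiffOn_iff_contDiffOn.1 h1) u₀ hu₀).mono_of_mem_nhdsWithin hmem
  have hinj : Function.Injective (fderivWithin ℝ (e ∘ ψ) s u₀) := by
    obtain ⟨A, hA⟩ := isInvertible_mfderivWithin_extChartAt_symm (I := I) hu₀
    rw [hfd u₀ hu₀]
    simp only [D, ψ, s, ← hA]
    exact (he.injective_mfderiv _).comp A.injective
  obtain ⟨B, hB, hBt, K, hK, hmain⟩ :=
    I.convex_range.exists_norm_sub_le_of_injective_fderivWithin (F := e ∘ ψ) hmem
      (fun u hu => (hchain e he.contMDiff u hu).differentiableWithinAt)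
      (hcd.continuousWithinAt_fderivWithin I.uniqueDiffOn one_ne_zero (hts hu₀)) hinj
  have htend : Filter.Tendsto (extChartAt I p) (𝓝 p) (𝓝[s] u₀) :=
    tendsto_nhdsWithin_iff.2 ⟨continuousAt_extChartAt p,
      Filter.Eventually.of_forall fun x => mem_range_self _⟩
  refine ⟨(extChartAt I p).source ∩ extChartAt I p ⁻¹' B,
    Filter.inter_mem (extChartAt_source_mem_nhds p) (htend hB), K, hK, ?_⟩
  rintro δ hδ f ⟨-, hf⟩ x ⟨hx, hxB⟩ y ⟨hy, hyB⟩
  have key := hmain δ hδ ((e ∘ f) ∘ ψ - e ∘ ψ) _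
    (fun u hu => (hchain (e ∘ f) (he.contMDiff.comp f.contMDiff) u (hBt hu)).sub
      (hchain e he.contMDiff u (hBt hu)))
    (fun u hu w => by
      rw [hfd u (hBt hu)]
      exact hf (ψ u) (mfderivWithin 𝓘(ℝ, E) I ψ s u w)) _ hxB _ hyB
  simpa only [Pi.sub_apply, Function.comp_apply, ψ, (extChartAt I p).left_inv hx,
    (extChartAt I p).left_inv hy] using key

/-- Displacements of diffeomorphisms of a compact manifold that are `C¹`-close to the identity are
Lipschitz with small constants. -/
theorem Diff1.exists_lipschitz_displacement [FiniteDimensional ℝ E] [IsManifold I 1 M]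
    [CompactSpace M] (he : IsC1Embedding I e) :
    ∃ K : ℝ, 0 ≤ K ∧ ∀ δ : ℝ, 0 ≤ δ → ∀ f : Diff1 I M, Diff1.IsClose I e δ f →
      ∀ x y, ‖(e (f x) - e x) - (e (f y) - e y)‖ ≤ K * δ * ‖e x - e y‖ := by
  let P : Set (M × M) → Prop := fun s => ∃ K : ℝ, 0 ≤ K ∧ ∀ δ : ℝ, 0 ≤ δ → ∀ f : Diff1 I M,
    Diff1.IsClose I e δ f → ∀ p ∈ s,
      ‖(e (f p.1) - e p.1) - (e (f p.2) - e p.2)‖ ≤ K * δ * ‖e p.1 - e p.2‖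
  have hP : P univ := by
    refine isCompact_univ.induction_on (p := P) ⟨0, le_rfl, by simp⟩ ?_ ?_ ?_
    · rintro s t hst ⟨K, hK, h⟩
      exact ⟨K, hK, fun δ hδ f hf p hp => h δ hδ f hf p (hst hp)⟩
    · rintro s t ⟨K, hK, h⟩ ⟨K', hK', h'⟩
      refine ⟨max K K', le_max_of_le_left hK, fun δ hδ f hf p hp => ?_⟩
      rcases hp with hp | hp
      · refine (h δ hδ f hf p hp).trans ?_
        gcongr
        exact le_max_left _ _
      · refine (h' δ hδ f hf p hp).trans ?_
        gcongr
        exact le_max_right _ _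
    · rintro ⟨p, q⟩ -
      rw [nhdsWithin_univ]
      by_cases hpq : p = q
      · subst hpq
        obtain ⟨W, hW, K, hK, h⟩ := Diff1.exists_lipschitz_displacement_nhds he p
        exact ⟨W ×ˢ W, prod_mem_nhds hW hW, K, hK,
          fun δ hδ f hf z hz => h δ hδ f hf z.1 hz.1 z.2 hz.2⟩
      · have hc : 0 < ‖e p - e q‖ :=
          norm_pos_iff.2 (sub_ne_zero.2 fun h => hpq (he.isEmbedding.injective h))
        have hcont : Continuous fun z : M × M => ‖e z.1 - e z.2‖ :=
          ((he.contMDiff.continuous.comp continuous_fst).sub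
            (he.contMDiff.continuous.comp continuous_snd)).norm
        refine ⟨{z | ‖e p - e q‖ / 2 < ‖e z.1 - e z.2‖},
          hcont.continuousAt.eventually (lt_mem_nhds (half_lt_self hc)), 4 / ‖e p - e q‖,
          by positivity, fun δ hδ f hf z hz => ?_⟩
        calc ‖(e (f z.1) - e z.1) - (e (f z.2) - e z.2)‖ ≤ δ + δ :=
              (norm_sub_le _ _).trans (add_le_add (hf.1 _) (hf.1 _))
          _ = 4 / ‖e p - e q‖ * δ * (‖e p - e q‖ / 2) := by field_simp; ring
          _ ≤ _ := mul_le_mul_of_nonneg_left (le_of_lt hz) (by positivity)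
  obtain ⟨K, hK, h⟩ := hP
  exact ⟨K, hK, fun δ hδ f hf x y => h δ hδ f hf (x, y) (mem_univ _)⟩

theorem Diff1.eventually_lipschitz_displacement [FiniteDimensional ℝ E] [IsManifold I 1 M]
    [CompactSpace M] (he : IsC1Embedding I e) {ε : ℝ} (hε : 0 < ε) :
    ∀ᶠ f in 𝓝 (1 : Diff1 I M), ∀ x y,
      ‖(e (f x) - e x) - (e (f y) - e y)‖ ≤ ε * ‖e x - e y‖ := by
  obtain ⟨K, hK, h⟩ := Diff1.exists_lipschitz_displacement (I := I) he
  filter_upwards [Diff1.eventually_isClose he (δ := ε / (K + 1)) (by positivity)] with f hf x y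
  refine (h _ (by positivity) f hf x y).trans (mul_le_mul_of_nonneg_right ?_ (norm_nonneg _))
  rw [mul_div_assoc', div_le_iff₀ (by positivity)]
  nlinarith

end Diff

end

theorem corollary1p2
    -- a compact connected surface, possibly with boundary, and a homeomorphism of it
    {S : Type*} [TopologicalSpace S] [T2Space S] [CompactSpace S] [ConnectedSpace S]
    [ChartedSpace (EuclideanHalfSpace 2) S]
    (φ : S ≃ₜ S)
    -- a compact smooth manifold, possibly with boundary or corners
    {E : Type*} [NormedAddCommGroup E] [NormedSpace ℝ E] [FiniteDimensional ℝ E]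
    {H : Type*} [TopologicalSpace H] (I : ModelWithCorners ℝ E H)
    (M : Type*) [TopologicalSpace M] [ChartedSpace H M] [IsManifold I ∞ M]
    [T2Space M] [CompactSpace M]
    (hφ : IsHyperbolic (SingularCohomology.pullback (φ : C(S, S))))
    (x₀ : S) :
    ∃ U ∈ 𝓝 (1 : FundamentalGroup (MappingTorus φ) (MappingTorus.fiberIncl φ x₀) →* Diff1 I M),
      ∀ ρ ∈ U, ∀ h ∈ MappingTorus.fiberGroup φ x₀, ρ h = 1 := by
  have : LocallyPathConnectedSpace S :=
    ChartedSpace.locallyPathConnectedSpace (EuclideanHalfSpace 2) S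
  have : PathConnectedSpace S := pathConnectedSpace_iff_connectedSpace.2 inferInstance
  have : IsManifold I 1 M := IsManifold.of_le (n := ∞) (by simp)
  obtain ⟨N, e, hsm, hemb, himm⟩ := exists_embedding_euclidean_of_compact (I := I) (M := M)
  have he : IsC1Embedding I e := ⟨hsm.of_le (by simp), hemb.isEmbedding, himm⟩
  obtain ⟨A, hA, hAf⟩ := Group.fg_iff.1
    (FundamentalGroup.fg_of_compactSpace (ChartedSpace.exists_uniqueIn_nhds (S := S) (n := 2)) x₀)
  let δ : Path x₀ (φ x₀) := PathConnectedSpace.somePath _ _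
  let j := FundamentalGroup.map (MappingTorus.fiberIncl φ) x₀
  obtain ⟨t, ht⟩ := MappingTorus.exists_conj_fiberGroup φ δ
  suffices hgen : ∀ᶠ ρ in 𝓝 (1 : FundamentalGroup (MappingTorus φ) (MappingTorus.fiberIncl φ x₀) →*
      Diff1 I M), ∀ a ∈ A, ρ (j a) = 1 by
    refine ⟨_, hgen, fun ρ hρ h hh => ?_⟩
    obtain ⟨γ, rfl⟩ := hh
    have hle : Subgroup.closure A ≤ (ρ.comp j).ker := (Subgroup.closure_le _).2 fun a ha => hρ a ha
    exact hle (hA ▸ Subgroup.mem_top γ)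
  by_contra hbad
  rw [Filter.not_eventually] at hbad
  have : (𝓝 (1 : FundamentalGroup (MappingTorus φ) (MappingTorus.fiberIncl φ x₀) →* Diff1 I M) ⊓
      Filter.principal {ρ | ¬ ∀ a ∈ A, ρ (j a) = 1}).NeBot := Filter.frequently_mem_iff_neBot.1 hbad
  have hev : ∀ g, Filter.Tendsto (fun ρ : FundamentalGroup (MappingTorus φ)
      (MappingTorus.fiberIncl φ x₀) →* Diff1 I M => ρ g) (𝓝 1) (𝓝 1) := fun g =>
    ((continuous_apply g).comp continuous_induced_dom).tendsto 1
  obtain ⟨D, hD0, hD⟩ := exists_character_of_displacement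
    (𝓝 (1 : FundamentalGroup (MappingTorus φ) (MappingTorus.fiberIncl φ x₀) →* Diff1 I M) ⊓
      Filter.principal {ρ | ¬ ∀ a ∈ A, ρ (j a) = 1}) (fun ρ g x => ρ g x)
    (fun ρ x => by rw [map_one]; rfl) (fun ρ g h x => by rw [map_mul]; rfl) e hsm.continuous
    (fun ρ g => (ρ g).continuous)
    (fun g ε hε => Filter.Eventually.filter_mono inf_le_left
      ((hev g).eventually (Diff1.eventually_lipschitz_displacement he hε)))
    j t (FundamentalGroup.mapAut φ δ) ht hAf hA (by
      refine Filter.Eventually.filter_mono inf_le_right (Filter.eventually_principal.2 ?_)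
      intro ρ hρ
      by_contra! h
      exact hρ fun a ha => Diffeomorph.ext fun x => hemb.injective (h a ha x))
  let coord : Fin N → EuclideanSpace ℝ (Fin N) →+ ℂ := fun i =>
    AddMonoidHom.mk' (fun v => (v i : ℂ)) fun v w => by simp
  obtain ⟨i, hi⟩ : ∃ i : Fin N, (coord i).comp D ≠ 0 := by
    by_contra! h
    refine hD0 (AddMonoidHom.ext fun g => ?_)
    ext i
    exact Complex.ofReal_injective (DFunLike.congr_fun (h i) g)
  obtain ⟨f, z, hf, hz, hfz⟩ := exists_character_norm_eq_one hAf hA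
    (FundamentalGroup.mapAut φ δ) _ hi 2 fun k a ha => by
      refine le_trans ?_ (hD k a ha)
      refine (Complex.norm_real _).le.trans ?_
      exact PiLp.norm_apply_le _ i
  exact hφ.2 z (SingularCohomology.hasEigenvalue_pullback φ δ f hf z hfz) hz
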